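/- Let $k$ be a commutative ring and let $A$ be an associative unital (not necessarily commutative) $k$-algebra that is finitely generated and projective as a $k$-module, with finite dual basis $\sum_i a_i^*\otimes a_i\in A^*\otimes_k A$, i.e. $\sum_i a_i^*(x)a_i=x$ for all $x\in A$. Write $f_i\in\mathrm{End}_k(A)$ for the map $f_i(x)=a_i^*(x)1$. Every left $\mathrm{End}_k(A)$-module $V$ is an $A$-bimodule by restriction of scalars along the algebra map $F:A\otimes_k A^{\rm op}\to \mathrm{End}_k(A)$, $F(a\otimes b)(x)=axb$, so that $av=F(a\otimes 1)\cdot v$ and $va=F(1\otimes a)\cdot v$. A right $A\otimes A$-comodule (over the Sweedler canonical coring) is a right $A$-module $V$ with a $k$-linear map $\rho:V\to V\otimes_k A$, $\rho(v)=v_{[0]}\otimes v_{[1]}$, such that $v_{[0]}v_{[1]}=v$, $\rho(v_{[0]})\otimes v_{[1]}=v_{[0]}\otimes 1\otimes v_{[1]}$ and $\rho(va)=v_{[0]}\otimes v_{[1]}a$; morphisms are the right $A$-linear maps that commute with the coactions. (1) The category of left $\mathrm{End}_k(A)$-modules is isomorphic to the category of right $A\otimes A$-comodules. The two mutually inverse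 functors leave underlying abelian groups and maps unchanged. A comodule $V$ becomes a module by $f\cdot v=v_{[0]}f(v_{[1]})$, and a module $V$ becomes a comodule by $\rho(v)=\sum_i f_i\cdot v\otimes a_i$, with right $A$-action by restriction of scalars as above. (2) The category of left $\mathrm{End}_k(A)$-modules is a braided monoidal category, as follows. The tensor product of $V$ and $W$ is $V\otimes_A W$, with action $$f\cdot(v\otimes_A w)=\sum_i f_i\cdot v\otimes_A f(a_i-)\cdot w=\sum_j f(-a_j)\cdot v\otimes_A f_j\cdot w$$ for $f\in\mathrm{End}_k(A)$, $v\in V$, $w\in W$, where $f(a-)$ and $f(-a)$ are the maps $x\mapsto f(ax)$ and $x\mapsto f(xa)$. The tensor product of morphisms is $(\varphi\otimes\psi)(v\otimes_A w)=\varphi(v)\otimes_A\psi(w)$. The unit object is $A$ with $f\cdot a=f(a)$. The associativity constraint is $(u\otimes_A v)\otimes_A w\mapsto u\otimes_A(v\otimes_A w)$ and the unit constraints are $a\otimes_A v\mapsto av$ and $v\otimes_A a\mapsto va$. The braiding $c_{V,W}:V\otimes_A W\to W\otimes_A V$ is $$c_{V,W}(v\otimes_A w)=\sum_i f_i\cdot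 w\otimes_A v\,a_i .$$ (3) Under the isomorphism of (1), the coaction on $V\otimes_A W$ is $\rho(v\otimes_A w)=v_{[0]}\otimes_A w_{[0]}\otimes v_{[1]}w_{[1]}$, the coaction on the unit object $A$ is $\rho(a)=1\otimes a$, and the braiding is $c_{V,W}(v\otimes_A w)=w_{[0]}\otimes_A v\,w_{[1]}$. -/

import Mathlib

open CategoryTheory MonoidalCategory MulOpposite
open scoped TensorProduct

universe u v w

noncomputable section

/-! ### Tensor product over a noncommutative ring -/

/-- The subgroup of `V ⊗[ℤ] W` generated by all `v a ⊗ w - v ⊗ a w`. A right `A`-module is a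
module over `Aᵐᵒᵖ`. -/
def TensorOver.relations (A : Type*) [Ring A] (V W : Type*) [AddCommGroup V] [Module Aᵐᵒᵖ V]
    [AddCommGroup W] [Module A W] : AddSubgroup (V ⊗[ℤ] W) :=
  AddSubgroup.closure
    {x | ∃ (v : V) (a : A) (w : W), x = (op a • v) ⊗ₜ[ℤ] w - v ⊗ₜ[ℤ] (a • w)}

/-- The tensor product `V ⊗_A W` of a right `A`-module `V` and a left `A`-module `W`, for a ring
`A` that need not be commutative. -/
def TensorOver (A : Type*) [Ring A] (V W : Type*) [AddCommGroup V] [Module Aᵐᵒᵖ V]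
    [AddCommGroup W] [Module A W] : Type _ :=
  (V ⊗[ℤ] W) ⧸ TensorOver.relations A V W

instance (A : Type*) [Ring A] (V W : Type*) [AddCommGroup V] [Module Aᵐᵒᵖ V]
    [AddCommGroup W] [Module A W] : AddCommGroup (TensorOver A V W) :=
  inferInstanceAs (AddCommGroup ((V ⊗[ℤ] W) ⧸ TensorOver.relations A V W))

/-- The pure tensor `v ⊗_A w`. -/
def TensorOver.tmul (A : Type*) [Ring A] {V W : Type*} [AddCommGroup V] [Module Aᵐᵒᵖ V]
    [AddCommGroup W] [Module A W] (v : V) (w : W) : TensorOver A V W :=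
  QuotientAddGroup.mk' (TensorOver.relations A V W) (v ⊗ₜ[ℤ] w)

/-! ### Modules over the endomorphism ring, and finite dual bases -/

/-- The category of left `End_k(A)`-modules. -/
abbrev EndMod (k : Type u) (A : Type v) [CommRing k] [Ring A] [Algebra k A] :=
  ModuleCat.{v} (Module.End k A)

namespace EndMod

variable {k : Type u} {A : Type v} [CommRing k] [Ring A] [Algebra k A]

/-- Left `A`-action on an `End_k(A)`-module: restriction of scalars along
`a ↦ F (a ⊗ 1)`, where `F (a ⊗ b) x = a x b`. -/
instance (V : EndMod k A) : Module A V :=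
  Module.compHom V
    ((AlgHom.mulLeftRight k A).comp Algebra.TensorProduct.includeLeft).toRingHom

/-- Right `A`-action on an `End_k(A)`-module: restriction of scalars along
`b ↦ F (1 ⊗ b)`, where `F (a ⊗ b) x = a x b`. -/
instance (V : EndMod k A) : Module Aᵐᵒᵖ V :=
  Module.compHom V
    ((AlgHom.mulLeftRight k A).comp Algebra.TensorProduct.includeRight).toRingHom

/-- The underlying `k`-module of an `End_k(A)`-module. -/
instance (V : EndMod k A) : Module k V :=
  Module.compHom V (algebraMap k (Module.End k A))

theorem left_smul_def {V : EndMod k A} (a : A) (v : V) :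
    a • v = AlgHom.mulLeftRight k A (a ⊗ₜ 1) • v := rfl

theorem right_smul_def {V : EndMod k A} (b : Aᵐᵒᵖ) (v : V) :
    b • v = AlgHom.mulLeftRight k A (1 ⊗ₜ b) • v := rfl

theorem base_smul_def {V : EndMod k A} (c : k) (v : V) :
    c • v = algebraMap k (Module.End k A) c • v := rfl

instance (V : EndMod k A) : IsScalarTower k Aᵐᵒᵖ V where
  smul_assoc c b v := by
    rw [right_smul_def, right_smul_def, base_smul_def, ← mul_smul]
    congr 1
    ext x
    simp

instance (V : EndMod k A) : SMulCommClass (Module.End k A) k V where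
  smul_comm f c v := by
    rw [base_smul_def, base_smul_def, ← mul_smul, ← mul_smul, Algebra.commutes]

/-- A morphism of left `End_k(A)`-modules is right `A`-linear. -/
def rightLin {V W : EndMod k A} (φ : V ⟶ W) : V →ₗ[Aᵐᵒᵖ] W where
  toFun := φ.hom
  map_add' := map_add φ.hom
  map_smul' b x := map_smul φ.hom (AlgHom.mulLeftRight k A (1 ⊗ₜ b)) x

end EndMod

/-- A finite dual basis `∑ i, aᵢ* ⊗ aᵢ` of the `k`-module `A`. -/
structure FiniteDualBasis (k : Type u) (A : Type v) [CommRing k] [Ring A] [Algebra k A]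
    (ι : Type w) [Fintype ι] where
  /-- the elements `aᵢ` -/
  vec : ι → A
  /-- the functionals `aᵢ*` -/
  coord : ι → Module.Dual k A
  sum_coord_smul_vec : ∀ x : A, ∑ i, coord i x • vec i = x

/-- The endomorphism `fᵢ = φ (aᵢ* ⊗ 1)`, that is `fᵢ x = aᵢ* x • 1`. -/
def FiniteDualBasis.endo {k : Type u} {A : Type v} [CommRing k] [Ring A] [Algebra k A]
    {ι : Type w} [Fintype ι] (D : FiniteDualBasis k A ι) (i : ι) : Module.End k A :=
  dualTensorHom k A A (D.coord i ⊗ₜ 1)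

/-! ### Comodules over the canonical coring `A ⊗ A` -/

/-- For a right `A`-module `V` over a `k`-algebra `A`, the map `V ⊗ A → V`, `v ⊗ a ↦ v a`. -/
def rightActionMap (k : Type*) (A : Type*) [CommRing k] [Ring A] [Algebra k A] (V : Type*)
    [AddCommGroup V] [Module k V] [Module Aᵐᵒᵖ V] [IsScalarTower k Aᵐᵒᵖ V] :
    V ⊗[k] A →ₗ[k] V :=
  TensorProduct.lift <| LinearMap.flip
    { toFun := fun a => { toFun := fun v => op a • v
                          map_add' := fun v w => smul_add _ v w
                          map_smul' := fun c v =>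
                            haveI : SMulCommClass k Aᵐᵒᵖ V := IsScalarTower.to_smulCommClass
                            (smul_comm c (op a) v).symm }
      map_add' := fun a b => by ext v; simp [add_smul]
      map_smul' := fun c a => by ext v; simp }

@[simp]
theorem rightActionMap_tmul (k : Type*) (A : Type*) [CommRing k] [Ring A] [Algebra k A]
    (V : Type*) [AddCommGroup V] [Module k V] [Module Aᵐᵒᵖ V] [IsScalarTower k Aᵐᵒᵖ V]
    (v : V) (a : A) : rightActionMap k A V (v ⊗ₜ a) = op a • v := rfl

/-- A right comodule over the Sweedler canonical coring `A ⊗ A`: a right `A`-module `V` with a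
`k`-linear map `ρ : V → V ⊗ A ≅ V ⊗_A (A ⊗ A)`, written `ρ v = v₀ ⊗ v₁`, such that `v₀ v₁ = v`,
`ρ v₀ ⊗ v₁ = v₀ ⊗ 1 ⊗ v₁` and `ρ (v a) = v₀ ⊗ v₁ a`. -/
structure SweedlerComod (k : Type u) (A : Type v) [CommRing k] [Ring A] [Algebra k A] where
  /-- the underlying type -/
  carrier : Type v
  [addCommGroup : AddCommGroup carrier]
  [baseModule : Module k carrier]
  [rightModule : Module Aᵐᵒᵖ carrier]
  [isScalarTower : IsScalarTower k Aᵐᵒᵖ carrier]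
  /-- the coaction -/
  coact : carrier →ₗ[k] carrier ⊗[k] A
  counit : ∀ x, rightActionMap k A carrier (coact x) = x
  coassoc : coact.rTensor A ∘ₗ coact =
    ((TensorProduct.mk k carrier A).flip 1).rTensor A ∘ₗ coact
  coact_smul : ∀ (a : A) (x : carrier),
    coact (op a • x) = (LinearMap.mulRight k a).lTensor carrier (coact x)

namespace SweedlerComod

variable {k : Type u} {A : Type v} [CommRing k] [Ring A] [Algebra k A]

instance : CoeSort (SweedlerComod k A) (Type v) := ⟨carrier⟩

attribute [instance] addCommGroup baseModule rightModule isScalarTower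

/-- Morphisms of comodules: right `A`-linear maps that commute with the coactions. -/
@[ext]
structure Hom (V W : SweedlerComod k A) where
  /-- the underlying right `A`-linear map -/
  toLin : V →ₗ[Aᵐᵒᵖ] W
  colinear : W.coact ∘ₗ toLin.restrictScalars k =
    (toLin.restrictScalars k).rTensor A ∘ₗ V.coact

instance : Category (SweedlerComod k A) where
  Hom := Hom
  id V := ⟨LinearMap.id, by
    ext x
    change _ = (LinearMap.id : V →ₗ[k] V).rTensor A (V.coact x)
    simp⟩
  comp {U V W} f g := ⟨g.toLin ∘ₗ f.toLin, by
    ext x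
    have hf := LinearMap.congr_fun f.colinear x
    have hg := LinearMap.congr_fun g.colinear (f.toLin x)
    simp only [LinearMap.comp_apply, LinearMap.restrictScalars_apply] at hf hg ⊢
    rw [hg, hf, ← LinearMap.rTensor_comp_apply]
    rfl⟩

/-- The action `f · v = v₀ f(v₁)`, as a `k`-linear map. -/
def endAct (V : SweedlerComod k A) (f : Module.End k A) : V →ₗ[k] V :=
  rightActionMap k A V ∘ₗ f.lTensor V ∘ₗ V.coact

theorem endAct_one (V : SweedlerComod k A) (x : V) : V.endAct 1 x = x := by
  have h : (1 : Module.End k A).lTensor V = LinearMap.id := LinearMap.lTensor_id V A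
  simp only [endAct, LinearMap.comp_apply, h, LinearMap.id_apply, V.counit]

theorem endAct_mul (V : SweedlerComod k A) (f g : Module.End k A) (x : V) :
    V.endAct (f * g) x = V.endAct f (V.endAct g x) := by
  let P : (V ⊗[k] A) ⊗[k] A →ₗ[k] V :=
    rightActionMap k A V ∘ₗ (f ∘ₗ LinearMap.mul' k A ∘ₗ g.lTensor A).lTensor V ∘ₗ
      (TensorProduct.assoc k V A A).toLinearMap
  have h₁ : ∀ t : V ⊗[k] A, V.endAct f (rightActionMap k A V (g.lTensor V t)) =
      P (V.coact.rTensor A t) := by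
    intro t
    induction t with
    | zero => simp
    | add s t hs ht => simp only [map_add, hs, ht]
    | tmul y b =>
      simp only [LinearMap.lTensor_tmul, rightActionMap_tmul, LinearMap.rTensor_tmul, endAct,
        LinearMap.comp_apply, V.coact_smul]
      generalize V.coact y = s
      induction s with
      | zero => simp
      | add s t hs ht => simp only [map_add, TensorProduct.add_tmul, hs, ht]
      | tmul z a => simp [P]
  have h₂ : ∀ t : V ⊗[k] A, P (((TensorProduct.mk k V A).flip 1).rTensor A t) =
      rightActionMap k A V ((f * g).lTensor V t) := by
    intro t
    induction t with
    | zero => simp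
    | add s t hs ht => simp only [map_add, hs, ht]
    | tmul y b => simp [P]
  have h₃ := LinearMap.congr_fun V.coassoc x
  simp only [LinearMap.comp_apply] at h₃
  change _ = V.endAct f (rightActionMap k A V (g.lTensor V (V.coact x)))
  rw [h₁, h₃, h₂]
  rfl

theorem endAct_add_left (V : SweedlerComod k A) (f g : Module.End k A) (x : V) :
    V.endAct (f + g) x = V.endAct f x + V.endAct g x := by
  simp [endAct, LinearMap.lTensor_add]

/-- The left `End_k(A)`-module structure `f · v = v₀ f(v₁)` on a comodule. -/
@[reducible]
def endModule (V : SweedlerComod k A) : Module (Module.End k A) V where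
  smul f x := V.endAct f x
  one_smul x := V.endAct_one x
  mul_smul f g x := V.endAct_mul f g x
  smul_zero f := map_zero (V.endAct f)
  smul_add f := map_add (V.endAct f)
  add_smul f g x := V.endAct_add_left f g x
  zero_smul x := by
    change V.endAct 0 x = 0
    simp [endAct]

/-- The functor from comodules to left `End_k(A)`-modules that keeps the underlying group and
the underlying map, with `f · v = v₀ f(v₁)`. -/
def toEndMod (k : Type u) (A : Type v) [CommRing k] [Ring A] [Algebra k A] :
    SweedlerComod k A ⥤ EndMod k A where
  obj V := @ModuleCat.of (Module.End k A) _ V _ V.endModule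
  map {V W} φ := @ModuleCat.ofHom (Module.End k A) _ V W _ V.endModule _ W.endModule
    (letI := V.endModule
     letI := W.endModule
     { toFun := φ.toLin
       map_add' := map_add φ.toLin
       map_smul' := fun f x => by
        change φ.toLin (V.endAct f x) = W.endAct f (φ.toLin x)
        have h := LinearMap.congr_fun φ.colinear x
        simp only [LinearMap.comp_apply, LinearMap.restrictScalars_apply] at h
        simp only [endAct, LinearMap.comp_apply, h]
        generalize V.coact x = s
        induction s with
        | zero => simp
        | add s t hs ht => simp only [map_add, hs, ht]
        | tmul z a => simp })

end SweedlerComod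

namespace FiniteDualBasis

variable {k : Type u} {A : Type v} [CommRing k] [Ring A] [Algebra k A] {ι : Type w} [Fintype ι]
  (D : FiniteDualBasis k A ι)

@[simp]
theorem endo_apply (i : ι) (x : A) : D.endo i x = D.coord i x • (1 : A) := rfl

/-- The coaction `ρ v = ∑ i, fᵢ · v ⊗ aᵢ` on a left `End_k(A)`-module. -/
def coact (V : EndMod k A) : V →ₗ[k] V ⊗[k] A where
  toFun x := ∑ i, (D.endo i • x) ⊗ₜ[k] D.vec i
  map_add' x y := by simp [TensorProduct.add_tmul, Finset.sum_add_distrib]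
  map_smul' c x := by
    simp [smul_comm _ c, Finset.smul_sum, TensorProduct.smul_tmul']

theorem coact_apply (V : EndMod k A) (x : V) :
    D.coact V x = ∑ i, (D.endo i • x) ⊗ₜ[k] D.vec i := rfl

theorem endo_comp_mulRight (a : A) (i : ι) :
    D.endo i * AlgHom.mulLeftRight k A (1 ⊗ₜ op a) =
      ∑ j, D.coord i (D.vec j * a) • D.endo j := by
  ext x
  simp only [Module.End.mul_apply, AlgHom.mulLeftRight_apply, one_mul, unop_op, endo_apply,
    LinearMap.sum_apply, LinearMap.smul_apply]
  conv_lhs => rw [← D.sum_coord_smul_vec x, Finset.sum_mul, map_sum, Finset.sum_smul]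
  refine Finset.sum_congr rfl fun j _ => ?_
  rw [smul_mul_assoc, map_smul, smul_eq_mul, smul_smul, mul_comm]

/-- The right `A ⊗ A`-comodule with coaction `ρ v = ∑ i, fᵢ · v ⊗ aᵢ` on a left
`End_k(A)`-module. -/
def comod (V : EndMod k A) : SweedlerComod k A where
  carrier := V
  coact := D.coact V
  counit x := by
    rw [coact_apply, map_sum]
    simp only [rightActionMap_tmul, EndMod.right_smul_def, ← mul_smul]
    rw [← Finset.sum_smul]
    convert one_smul (Module.End k A) x
    ext y
    simp [D.sum_coord_smul_vec]
  coassoc := by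
    ext x
    simp only [LinearMap.comp_apply, coact_apply, map_sum, LinearMap.rTensor_tmul]
    refine Finset.sum_congr rfl fun i _ => ?_
    congr 1
    have h : ∀ j, D.endo j • D.endo i • x = D.coord j 1 • D.endo i • x := by
      intro j
      rw [EndMod.base_smul_def, ← mul_smul, ← mul_smul]
      congr 1
      ext y
      simp [smul_smul]
    simp only [h, TensorProduct.smul_tmul, ← TensorProduct.tmul_sum, D.sum_coord_smul_vec]
    rfl
  coact_smul a x := by
    simp only [coact_apply, map_sum, LinearMap.lTensor_tmul, LinearMap.mulRight_apply,
      EndMod.right_smul_def, ← mul_smul, endo_comp_mulRight, Finset.sum_smul,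
      TensorProduct.sum_tmul]
    rw [Finset.sum_comm]
    refine Finset.sum_congr rfl fun j _ => ?_
    have h : ∀ i, (D.coord i (D.vec j * a) • D.endo j) • x =
        D.coord i (D.vec j * a) • (D.endo j • x) := by
      intro i
      rw [EndMod.base_smul_def, ← mul_smul, Algebra.smul_def]
    simp only [h, TensorProduct.smul_tmul, ← TensorProduct.tmul_sum, D.sum_coord_smul_vec]

theorem coact_map {V W : EndMod k A} (φ : V ⟶ W) (x : V) :
    D.coact W (φ.hom x) = ((EndMod.rightLin φ).restrictScalars k).rTensor A (D.coact V x) := by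
  rw [coact_apply, coact_apply, map_sum]
  refine Finset.sum_congr rfl fun i _ => ?_
  rw [← map_smul]
  rfl

/-- The functor from left `End_k(A)`-modules to comodules that keeps the underlying group and
the underlying map, with coaction `ρ v = ∑ i, fᵢ · v ⊗ aᵢ`. -/
def toComod : EndMod k A ⥤ SweedlerComod k A where
  obj V := D.comod V
  map {V W} φ :=
    ⟨EndMod.rightLin φ, LinearMap.ext fun x => D.coact_map φ x⟩

end FiniteDualBasis

end

noncomputable section

/-! ### Maps out of the tensor product over a noncommutative ring -/

namespace TensorOver

variable {A : Type*} [Ring A] {V W X : Type*} [AddCommGroup V] [Module Aᵐᵒᵖ V]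
  [AddCommGroup W] [Module A W] [AddCommGroup X]

/-! The proof is a form of descent. Call v in an `End_k(A)`-module coinvariant if f · v = v f(1) for
every f, that is, if ρ(v) = v ⊗ 1. Since fᵢ takes values in k · 1, every fᵢ · v is coinvariant, and
the dual basis identity gives v = ∑ (fᵢ · v) aᵢ. So coinvariants generate V as a right A-module. A
coinvariant satisfies av = va and f · (va) = v f(a), so all actions on it are explicit
(`isCoinv_endo_smul`, `sum_right_smul_endo_smul`).

Consequently V ⊗_A W is additively spanned by tensors v ⊗ w with v coinvariant. On these the sum
defining the action collapses to f · (v ⊗ w) = v ⊗ f · w (`tensorAct_tmul_of_isCoinv`), which makes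
the module axioms and the linearity of the structure maps immediate. If w is coinvariant as well, so
is v ⊗ w. Such tensors generate V ⊗_A W under right multiplication, so morphisms need only be
compared on them (`tensorObj_hom_ext`). There the braiding is the flip (`braidHom_tm_of_isCoinv`),
so naturality, the hexagons and invertibility are those of the flip.

That the sums over the dual basis are well defined over A rests on one identity, ρ(f · v) = v₀ ⊗
f(v₁) (`sum_endo_smul_smul`), applied with f a left or right multiplication.

For the isomorphism of categories, applying fᵢ to v₁ in v₀ ⊗ v₁ and summing against aᵢ recovers
ρ(v), while ∑ (fᵢ · v) f(aᵢ) = f · v recovers the action. Both functors keep carriers, so the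
composites are equal to the identities on the nose. -/

theorem add_tmul (v v' : V) (w : W) : tmul A (v + v') w = tmul A v w + tmul A v' w := by
  simp only [tmul, TensorProduct.add_tmul, map_add]
  rfl

theorem tmul_add (v : V) (w w' : W) : tmul A v (w + w') = tmul A v w + tmul A v w' := by
  simp only [tmul, TensorProduct.tmul_add, map_add]
  rfl

theorem smul_tmul (a : A) (v : V) (w : W) : tmul A (op a • v) w = tmul A v (a • w) := by
  refine (QuotientAddGroup.eq_iff_sub_mem).2 ?_
  exact AddSubgroup.subset_closure ⟨v, a, w, rfl⟩

variable (A V W) in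
/-- The biadditive map `(v, w) ↦ v ⊗_A w`. -/
def mk : V →+ W →+ TensorOver A V W :=
  AddMonoidHom.mk' (fun v => AddMonoidHom.mk' (tmul A v) (tmul_add v))
    fun v v' => AddMonoidHom.ext (add_tmul v v')

theorem sum_tmul {ι : Type*} (s : Finset ι) (v : ι → V) (w : W) :
    tmul A (∑ i ∈ s, v i) w = ∑ i ∈ s, tmul A (v i) w :=
  map_sum ((mk A V W).flip w) v s

theorem tmul_sum {ι : Type*} (s : Finset ι) (v : V) (w : ι → W) :
    tmul A v (∑ i ∈ s, w i) = ∑ i ∈ s, tmul A v (w i) :=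
  map_sum (mk A V W v) w s

/-- The additive map `V ⊗_A W → X` induced by an `A`-balanced biadditive map. -/
def lift (B : V →+ W →+ X) (h : ∀ v (a : A) w, B (op a • v) w = B v (a • w)) :
    TensorOver A V W →+ X :=
  QuotientAddGroup.lift _
    (TensorProduct.liftAddHom B fun n v w => by rw [map_zsmul, map_zsmul]; rfl) <| by
      rw [relations, AddSubgroup.closure_le]
      rintro _ ⟨v, a, w, rfl⟩
      change TensorProduct.liftAddHom B _ _ = 0
      rw [map_sub, TensorProduct.liftAddHom_tmul, TensorProduct.liftAddHom_tmul, h, sub_self]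

theorem induction_on {p : TensorOver A V W → Prop} (t : TensorOver A V W) (zero : p 0)
    (tmul : ∀ v w, p (tmul A v w)) (add : ∀ s t, p s → p t → p (s + t)) : p t := by
  obtain ⟨t, rfl⟩ := QuotientAddGroup.mk'_surjective _ t
  induction t with
  | zero => exact zero
  | tmul v w => exact tmul v w
  | add s t hs ht => exact add _ _ hs ht

end TensorOver

/-! ### Coinvariants of modules over the endomorphism ring -/

namespace EndMod

variable {k : Type u} {A : Type v} [CommRing k] [Ring A] [Algebra k A]

theorem left_smul_eq {V : EndMod k A} (a : A) (v : V) :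
    a • v = LinearMap.mulLeft k a • v := by
  rw [left_smul_def]
  congr 1
  ext x
  simp

theorem right_smul_eq {V : EndMod k A} (a : A) (v : V) :
    op a • v = LinearMap.mulRight k a • v := by
  rw [right_smul_def]
  congr 1
  ext x
  simp

theorem base_smul_eq_right {V : EndMod k A} (c : k) (v : V) :
    c • v = op (algebraMap k A c) • v := by
  rw [right_smul_eq, base_smul_def]
  congr 1
  ext x
  simp [Algebra.algebraMap_eq_smul_one]

theorem base_smul_eq_left {V : EndMod k A} (c : k) (v : V) :
    c • v = algebraMap k A c • v := by
  rw [left_smul_eq, base_smul_def]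
  congr 1
  ext x
  simp [Algebra.algebraMap_eq_smul_one]

/-- Scalars from k act through A, and equally from either side, so a tensor balanced over A is
balanced over k. -/
theorem smul_tmul {V W : EndMod k A} (c : k) (v : V) (w : W) :
    TensorOver.tmul A (c • v) w = TensorOver.tmul A v (c • w) := by
  rw [base_smul_eq_right, TensorOver.smul_tmul, ← base_smul_eq_left]

theorem smul_right_comm {V : EndMod k A} (a b : A) (v : V) :
    a • op b • v = op b • a • v := by
  simp only [left_smul_eq, right_smul_eq, ← mul_smul]
  congr 1
  ext x
  simp [mul_assoc]

/-- An element `v` with `f · v = v f(1)` for all `f`; equivalently `ρ v = v ⊗ 1`. -/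
def IsCoinv {V : EndMod k A} (v : V) : Prop :=
  ∀ f : Module.End k A, f • v = op (f 1) • v

namespace IsCoinv

variable {V W : EndMod k A} {v : V}

theorem left_smul (h : IsCoinv v) (a : A) : a • v = op a • v := by
  rw [left_smul_eq, h, LinearMap.mulLeft_apply, mul_one]

/-- The left side is the action of f ∘ (right multiplication by a), which sends 1 to f(a). -/
theorem smul_right_smul (h : IsCoinv v) (f : Module.End k A) (a : A) :
    f • op a • v = op (f a) • v := by
  rw [right_smul_eq, ← mul_smul, h]
  simp

theorem map (h : IsCoinv v) (φ : V ⟶ W) : IsCoinv (φ.hom v) := fun f => by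
  rw [← map_smul, h, right_smul_eq, map_smul, right_smul_eq]

end IsCoinv

end EndMod

/-! ### Dual basis identities and generation by coinvariants -/

namespace FiniteDualBasis

open EndMod

variable {k : Type u} {A : Type v} [CommRing k] [Ring A] [Algebra k A] {ι : Type w} [Fintype ι]
  (D : FiniteDualBasis k A ι)

/-- As fᵢ takes values in k · 1, applying f after fᵢ amounts to multiplying its values by f(1). -/
theorem isCoinv_endo_smul {V : EndMod k A} (i : ι) (v : V) : IsCoinv (D.endo i • v) := fun f => by
  rw [right_smul_eq, ← mul_smul, ← mul_smul]
  congr 1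
  ext x
  simp

theorem sum_right_smul_endo_smul {V : EndMod k A} (v : V) :
    ∑ i, op (D.vec i) • D.endo i • v = v := by
  simp only [right_smul_eq, ← mul_smul]
  rw [← Finset.sum_smul]
  convert one_smul (Module.End k A) v
  ext x
  simp [D.sum_coord_smul_vec]

/-- Expand the argument in the dual basis and use k-linearity. This is the operator form of ρ(f · v)
= v₀ ⊗ f(v₁). -/
theorem endo_mul (i : ι) (f : Module.End k A) :
    D.endo i * f = ∑ j, D.coord i (f (D.vec j)) • D.endo j := by
  ext x
  simp only [Module.End.mul_apply, endo_apply, LinearMap.sum_apply, LinearMap.smul_apply]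
  conv_lhs => rw [← D.sum_coord_smul_vec x, map_sum, map_sum, Finset.sum_smul]
  refine Finset.sum_congr rfl fun j _ => ?_
  rw [map_smul, map_smul, smul_eq_mul, smul_smul, mul_comm]

/-- The coaction satisfies `ρ (f · v) = v₀ ⊗ f(v₁)`, tested against a balanced biadditive map. -/
theorem sum_endo_smul_smul {V : EndMod k A} {X : Type*} [AddCommGroup X] (B : V →+ A →+ X)
    (hB : ∀ (c : k) v a, B (c • v) a = B v (c • a)) (f : Module.End k A) (v : V) :
    ∑ i, B (D.endo i • f • v) (D.vec i) = ∑ j, B (D.endo j • v) (f (D.vec j)) := by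
  have h : ∀ i, D.endo i • f • v = ∑ j, D.coord i (f (D.vec j)) • D.endo j • v := by
    intro i
    rw [← mul_smul, endo_mul, Finset.sum_smul]
    refine Finset.sum_congr rfl fun j _ => ?_
    rw [base_smul_def, ← mul_smul, Algebra.smul_def]
  simp only [h, map_sum, AddMonoidHom.finsetSum_apply, hB]
  rw [Finset.sum_comm]
  refine Finset.sum_congr rfl fun j _ => ?_
  rw [← map_sum, D.sum_coord_smul_vec]

/-- This is ρ(v) = v ⊗ 1 tested against B: here fᵢ · v = aᵢ*(1) v, and ∑ aᵢ*(1) aᵢ = 1. It collapses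
the sums in the tensor action and in the braiding. -/
theorem sum_endo_smul_of_isCoinv {V : EndMod k A} {X : Type*} [AddCommGroup X] (B : V →+ A →+ X)
    (hB : ∀ (c : k) v a, B (c • v) a = B v (c • a)) {v : V} (hv : IsCoinv v) :
    ∑ i, B (D.endo i • v) (D.vec i) = B v 1 := by
  have h : ∀ i, D.endo i • v = D.coord i 1 • v := by
    intro i
    rw [hv, endo_apply, base_smul_eq_right, Algebra.algebraMap_eq_smul_one]
  simp only [h, hB]
  rw [← map_sum, D.sum_coord_smul_vec]

theorem tmul_eq_sum {V W : EndMod k A} (v : V) (w : W) :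
    TensorOver.tmul A v w = ∑ i, TensorOver.tmul A (D.endo i • v) (D.vec i • w) := by
  simp only [← TensorOver.smul_tmul]
  rw [← TensorOver.sum_tmul, D.sum_right_smul_endo_smul]

/-- Write v = ∑ (fᵢ · v) aᵢ and move each aᵢ across the tensor sign; the first factors that remain
are coinvariant. -/
theorem induction_isCoinv (D : FiniteDualBasis k A ι) {V W : EndMod k A}
    {p : TensorOver A V W → Prop} (t : TensorOver A V W) (zero : p 0)
    (add : ∀ s t, p s → p t → p (s + t))
    (tmul : ∀ v w, IsCoinv v → p (TensorOver.tmul A v w)) : p t := by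
  induction t using TensorOver.induction_on with
  | zero => exact zero
  | add s t hs ht => exact add s t hs ht
  | tmul v w =>
    rw [D.tmul_eq_sum]
    exact Finset.sum_induction _ p add zero fun i _ => tmul _ _ (D.isCoinv_endo_smul i v)

end FiniteDualBasis

namespace FiniteDualBasis

open EndMod

variable {k : Type u} {A : Type v} [CommRing k] [Ring A] [Algebra k A] {ι : Type w} [Fintype ι]
  (D : FiniteDualBasis k A ι)

/-! ### The tensor product of modules over the endomorphism ring -/

/-- The biadditive map `(v, a) ↦ v ⊗ f · (a w)`. -/
def tmulAct (V : EndMod k A) {W : EndMod k A} (f : Module.End k A) (w : W) :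
    V →+ A →+ TensorOver A V W :=
  AddMonoidHom.mk' (fun v => AddMonoidHom.mk' (fun b => TensorOver.tmul A v (f • b • w))
    fun b b' => by simp only [add_smul, smul_add, TensorOver.tmul_add])
    fun v v' => AddMonoidHom.ext fun b => TensorOver.add_tmul _ _ _

theorem tmulAct_apply {V W : EndMod k A} (f : Module.End k A) (w : W) (v : V) (a : A) :
    tmulAct V f w v a = TensorOver.tmul A v (f • a • w) := rfl

theorem tmulAct_balanced {V W : EndMod k A} (f : Module.End k A) (w : W) (c : k) (v : V) (a : A) :
    tmulAct V f w (c • v) a = tmulAct V f w v (c • a) := by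
  rw [tmulAct_apply, tmulAct_apply, EndMod.smul_tmul, Algebra.smul_def, mul_smul,
    ← base_smul_eq_left, smul_comm f c]

/-- The additive map `v ⊗ w ↦ ∑ i, fᵢ · v ⊗ f(aᵢ -) · w`. -/
def tensorAct (V W : EndMod k A) (f : Module.End k A) : TensorOver A V W →+ TensorOver A V W :=
  TensorOver.lift
    (AddMonoidHom.mk' (fun v => AddMonoidHom.mk'
      (fun w => ∑ i, TensorOver.tmul A (D.endo i • v) ((f * LinearMap.mulLeft k (D.vec i)) • w))
      fun w w' => by simp only [smul_add, TensorOver.tmul_add, Finset.sum_add_distrib])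
      fun v v' => AddMonoidHom.ext fun w => by
        simp [smul_add, TensorOver.add_tmul, Finset.sum_add_distrib]) <| by
    intro v a w
    -- Balancedness over A is ρ(va) = v₀ ⊗ v₁a, evaluated under (v, b) ↦ v ⊗ f · (b w).
    have h := D.sum_endo_smul_smul (tmulAct V f w) (tmulAct_balanced f w)
      (LinearMap.mulRight k a) v
    simpa only [tmulAct_apply, left_smul_eq, right_smul_eq, ← mul_smul, mul_assoc,
      AddMonoidHom.mk'_apply, LinearMap.mulRight_apply, LinearMap.mulLeft_mul,
      ← Module.End.mul_eq_comp] using h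

theorem tensorAct_tmul {V W : EndMod k A} (f : Module.End k A) (v : V) (w : W) :
    D.tensorAct V W f (TensorOver.tmul A v w) =
      ∑ i, TensorOver.tmul A (D.endo i • v) ((f * LinearMap.mulLeft k (D.vec i)) • w) := rfl

/-- Replacing ρ(v) by v ⊗ 1 leaves the single term f(1 -) · w. In this form the action is visibly
additive and multiplicative in f. -/
theorem tensorAct_tmul_of_isCoinv {V W : EndMod k A} (f : Module.End k A) {v : V}
    (hv : IsCoinv v) (w : W) :
    D.tensorAct V W f (TensorOver.tmul A v w) = TensorOver.tmul A v (f • w) := by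
  have h := D.sum_endo_smul_of_isCoinv (tmulAct V f w) (tmulAct_balanced f w) hv
  simpa only [tmulAct_apply, left_smul_eq (_ : A) w, mul_smul, tensorAct_tmul,
    LinearMap.mulLeft_one, ← Module.End.one_eq_id, one_smul] using h

/-- The left `End_k(A)`-module `V ⊗_A W`. -/
@[reducible]
def tensorModule (V W : EndMod k A) : Module (Module.End k A) (TensorOver A V W) where
  smul f := D.tensorAct V W f
  one_smul t := by
    change D.tensorAct V W 1 t = t
    induction t using D.induction_isCoinv with
    | zero => simp
    | add s t hs ht => rw [map_add, hs, ht]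
    | tmul v w hv => rw [D.tensorAct_tmul_of_isCoinv _ hv, one_smul]
  mul_smul f g t := by
    change D.tensorAct V W (f * g) t = D.tensorAct V W f (D.tensorAct V W g t)
    induction t using D.induction_isCoinv with
    | zero => simp
    | add s t hs ht => simp only [map_add, hs, ht]
    | tmul v w hv => simp only [D.tensorAct_tmul_of_isCoinv _ hv, mul_smul]
  smul_zero f := map_zero (D.tensorAct V W f)
  smul_add f := map_add (D.tensorAct V W f)
  add_smul f g t := by
    change D.tensorAct V W (f + g) t = D.tensorAct V W f t + D.tensorAct V W g t
    induction t using D.induction_isCoinv with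
    | zero => simp
    | add s t hs ht => simp only [map_add, hs, ht]; abel
    | tmul v w hv => simp only [D.tensorAct_tmul_of_isCoinv _ hv, add_smul, TensorOver.tmul_add]
  zero_smul t := by
    change D.tensorAct V W 0 t = 0
    induction t using D.induction_isCoinv with
    | zero => simp
    | add s t hs ht => simp only [map_add, hs, ht, add_zero]
    | tmul v w hv =>
      rw [D.tensorAct_tmul_of_isCoinv _ hv, zero_smul]
      exact map_zero (TensorOver.mk A V W v)

/-- `V ⊗_A W` as an object of the category of left `End_k(A)`-modules. -/
def tensorObj (V W : EndMod k A) : EndMod k A :=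
  @ModuleCat.of (Module.End k A) _ (TensorOver A V W) _ (D.tensorModule V W)

/-- The underlying group of `tensorObj` is `V ⊗_A W`. -/
def tensorEquiv (V W : EndMod k A) : TensorOver A V W ≃+ D.tensorObj V W :=
  AddEquiv.refl (TensorOver A V W)

/-- The pure tensor `v ⊗_A w` in `tensorObj`. -/
def tm {V W : EndMod k A} (v : V) (w : W) : D.tensorObj V W :=
  D.tensorEquiv V W (TensorOver.tmul A v w)

section tm

variable {U V W : EndMod k A}

theorem add_tm (v v' : V) (w : W) : D.tm (v + v') w = D.tm v w + D.tm v' w :=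
  TensorOver.add_tmul v v' w

theorem tm_add (v : V) (w w' : W) : D.tm v (w + w') = D.tm v w + D.tm v w' :=
  TensorOver.tmul_add v w w'

theorem sum_tm {κ : Type*} (s : Finset κ) (v : κ → V) (w : W) :
    D.tm (∑ i ∈ s, v i) w = ∑ i ∈ s, D.tm (v i) w :=
  TensorOver.sum_tmul s v w

theorem tm_sum {κ : Type*} (s : Finset κ) (v : V) (w : κ → W) :
    D.tm v (∑ i ∈ s, w i) = ∑ i ∈ s, D.tm v (w i) :=
  TensorOver.tmul_sum s v w

theorem right_smul_tm (a : A) (v : V) (w : W) : D.tm (op a • v) w = D.tm v (a • w) :=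
  TensorOver.smul_tmul a v w

theorem base_smul_tm (c : k) (v : V) (w : W) : D.tm (c • v) w = D.tm v (c • w) :=
  EndMod.smul_tmul c v w

theorem smul_tm_of_isCoinv (f : Module.End k A) {v : V} (hv : IsCoinv v) (w : W) :
    f • D.tm v w = D.tm v (f • w) :=
  D.tensorAct_tmul_of_isCoinv f hv w

theorem tm_eq_sum (v : V) (w : W) : D.tm v w = ∑ i, D.tm (D.endo i • v) (D.vec i • w) :=
  D.tmul_eq_sum v w

theorem right_smul_tm_eq (a : A) (v : V) (w : W) : op a • D.tm v w = D.tm v (op a • w) := by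
  simp only [D.tm_eq_sum v, Finset.smul_sum]
  refine Finset.sum_congr rfl fun i _ => ?_
  rw [right_smul_eq, D.smul_tm_of_isCoinv _ (D.isCoinv_endo_smul i v), ← right_smul_eq,
    smul_right_comm]

/-- For a coinvariant first factor, a can be carried through the second factor and back, since left
and right multiplication agree on coinvariants. The general case follows by expanding v = ∑ (fᵢ · v)
aᵢ. -/
theorem left_smul_tm_eq (a : A) (v : V) (w : W) : a • D.tm v w = D.tm (a • v) w := by
  conv_lhs => rw [D.tm_eq_sum v, Finset.smul_sum]
  conv_rhs => rw [← D.sum_right_smul_endo_smul v, Finset.smul_sum, D.sum_tm]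
  refine Finset.sum_congr rfl fun i _ => ?_
  have h := D.isCoinv_endo_smul i v
  rw [left_smul_eq, D.smul_tm_of_isCoinv _ h, ← left_smul_eq, ← D.right_smul_tm, ← h.left_smul,
    ← D.right_smul_tm, smul_right_comm]

variable {D} in
theorem _root_.EndMod.IsCoinv.tm {v : V} {w : W} (hv : IsCoinv v) (hw : IsCoinv w) :
    IsCoinv (D.tm v w) := fun f => by
  rw [D.smul_tm_of_isCoinv f hv, hw, D.right_smul_tm_eq]

theorem tm_induction {p : D.tensorObj V W → Prop} (t : D.tensorObj V W) (zero : p 0)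
    (add : ∀ s t, p s → p t → p (s + t)) (tm : ∀ v w, IsCoinv v → p (D.tm v w)) : p t :=
  D.induction_isCoinv (p := p) t zero add tm

/-- Additive maps out of `V ⊗_A W` are determined by the `v ⊗ w` with `v` coinvariant. -/
theorem addHom_ext {X : Type*} [AddCommGroup X] {g h : D.tensorObj V W →+ X}
    (H : ∀ v w, IsCoinv v → g (D.tm v w) = h (D.tm v w)) : g = h := by
  ext t
  induction t using D.tm_induction with
  | zero => simp
  | add s t hs ht => rw [map_add, map_add, hs, ht]
  | tm v w hv => exact H v w hv

theorem eq_sum_right_smul_tm (v : V) (w : W) :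
    D.tm v w = ∑ i, op (D.vec i) • D.tm v (D.endo i • w) := by
  simp only [D.right_smul_tm_eq, ← D.tm_sum, D.sum_right_smul_endo_smul]

theorem zero_tm (w : W) : D.tm (0 : V) w = 0 :=
  map_zero ((TensorOver.mk A V W).flip w)

theorem tm_zero (v : V) : D.tm v (0 : W) = 0 :=
  map_zero (TensorOver.mk A V W v)

theorem tm_induction_left {p : D.tensorObj (D.tensorObj U V) W → Prop}
    (t : D.tensorObj (D.tensorObj U V) W) (zero : p 0) (add : ∀ s t, p s → p t → p (s + t))
    (tm : ∀ u v w, IsCoinv u → IsCoinv v → p (D.tm (D.tm u v) w)) : p t := by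
  induction t using D.tm_induction with
  | zero => exact zero
  | add s t hs ht => exact add s t hs ht
  | tm s w hs =>
    -- The summands of a coinvariant tensor need not be coinvariant, so this hypothesis would not
    -- survive the induction.
    clear hs
    induction s using D.tm_induction with
    | zero => rwa [D.zero_tm]
    | add s t hs ht => rw [D.add_tm]; exact add _ _ hs ht
    | tm u v hu =>
      -- The coefficients that make v coinvariant are moved into the third factor.
      rw [D.eq_sum_right_smul_tm u v, D.sum_tm]
      refine Finset.sum_induction _ p add zero fun i _ => ?_
      rw [D.right_smul_tm]
      exact tm _ _ _ hu (D.isCoinv_endo_smul i v)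

/-- Additive maps out of `(U ⊗_A V) ⊗_A W` are determined by the `(u ⊗ v) ⊗ w` with `u` and `v`
coinvariant. -/
theorem addHom_ext_left {X : Type*} [AddCommGroup X]
    {g h : D.tensorObj (D.tensorObj U V) W →+ X}
    (H : ∀ u v w, IsCoinv u → IsCoinv v → g (D.tm (D.tm u v) w) = h (D.tm (D.tm u v) w)) :
    g = h := by
  ext t
  induction t using D.tm_induction_left with
  | zero => rw [map_zero, map_zero]
  | add s t hs ht => rw [map_add, map_add, hs, ht]
  | tm u v w hu hv => exact H u v w hu hv

/-- Additive maps out of `U ⊗_A (V ⊗_A W)` are determined by the `u ⊗ (v ⊗ w)` with `u` and `v`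
coinvariant. -/
theorem addHom_ext_right {X : Type*} [AddCommGroup X]
    {g h : D.tensorObj U (D.tensorObj V W) →+ X}
    (H : ∀ u v w, IsCoinv u → IsCoinv v → g (D.tm u (D.tm v w)) = h (D.tm u (D.tm v w))) :
    g = h := by
  refine D.addHom_ext fun u t hu => ?_
  induction t using D.tm_induction with
  | zero => rw [D.tm_zero, map_zero, map_zero]
  | add s t hs ht => rw [D.tm_add, map_add, map_add, hs, ht]
  | tm v w hv => exact H u v w hu hv

variable {X : EndMod k A}

/-- Morphisms out of `V ⊗_A W` are determined by the `v ⊗ w` with `v` and `w` coinvariant. -/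
theorem tensorObj_hom_ext {φ ψ : D.tensorObj V W ⟶ X}
    (H : ∀ v w, IsCoinv v → IsCoinv w → φ.hom (D.tm v w) = ψ.hom (D.tm v w)) : φ = ψ := by
  refine ModuleCat.hom_ext (LinearMap.toAddMonoidHom_injective (D.addHom_ext fun v w hv => ?_))
  -- Right multiplication by A is part of the `End_k(A)`-action, so morphisms commute with it and w
  -- may be replaced by the coinvariants fᵢ · w. Mere additive maps do not allow this.
  rw [D.eq_sum_right_smul_tm, map_sum, map_sum]
  refine Finset.sum_congr rfl fun i _ => ?_
  simp only [right_smul_eq, LinearMap.toAddMonoidHom_coe, map_smul]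
  rw [H v _ hv (D.isCoinv_endo_smul i w)]

theorem tensorObj_hom_ext_left {φ ψ : D.tensorObj (D.tensorObj U V) W ⟶ X}
    (H : ∀ u v w, IsCoinv u → IsCoinv v → IsCoinv w →
      φ.hom (D.tm (D.tm u v) w) = ψ.hom (D.tm (D.tm u v) w)) : φ = ψ := by
  refine ModuleCat.hom_ext
    (LinearMap.toAddMonoidHom_injective (D.addHom_ext_left fun u v w hu hv => ?_))
  rw [D.eq_sum_right_smul_tm, map_sum, map_sum]
  refine Finset.sum_congr rfl fun i _ => ?_
  simp only [right_smul_eq, LinearMap.toAddMonoidHom_coe, map_smul]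
  rw [H u v _ hu hv (D.isCoinv_endo_smul i w)]

theorem tensorObj_hom_ext_right {φ ψ : D.tensorObj U (D.tensorObj V W) ⟶ X}
    (H : ∀ u v w, IsCoinv u → IsCoinv v → IsCoinv w →
      φ.hom (D.tm u (D.tm v w)) = ψ.hom (D.tm u (D.tm v w))) : φ = ψ := by
  refine D.tensorObj_hom_ext fun u t hu _ => ?_
  clear * - H hu
  induction t using D.tm_induction with
  | zero => rw [D.tm_zero, map_zero, map_zero]
  | add s t hs ht => rw [D.tm_add, map_add, map_add, hs, ht]
  | tm v w hv =>
    rw [D.eq_sum_right_smul_tm v w, D.tm_sum, map_sum, map_sum]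
    refine Finset.sum_congr rfl fun i _ => ?_
    rw [← D.right_smul_tm_eq]
    simp only [right_smul_eq, map_smul]
    rw [H u v _ hu hv (D.isCoinv_endo_smul i w)]

end tm

/-! ### Morphisms out of a tensor product -/

section lift

variable {V W X : EndMod k A}

/-- The additive map out of `V ⊗_A W` induced by an `A`-balanced biadditive map. -/
def liftAdd (D : FiniteDualBasis k A ι) {X : Type*} [AddCommGroup X] (B : V → W → X)
    (hadd : ∀ v v' w, B (v + v') w = B v w + B v' w)
    (hadd' : ∀ v w w', B v (w + w') = B v w + B v w')
    (h : ∀ v (a : A) w, B (op a • v) w = B v (a • w)) : D.tensorObj V W →+ X :=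
  TensorOver.lift (AddMonoidHom.mk' (fun v => AddMonoidHom.mk' (B v) (hadd' v))
    fun v v' => AddMonoidHom.ext (hadd v v')) h

theorem liftAdd_tm {X : Type*} [AddCommGroup X] (B : V → W → X) (hadd hadd' h) (v : V) (w : W) :
    D.liftAdd B hadd hadd' h (D.tm v w) = B v w := rfl

/-- The `End_k(A)`-linear map with a given underlying additive map. -/
def homOfAdd {V W : EndMod k A} (g : V →+ W) (h : ∀ (f : Module.End k A) v, g (f • v) = f • g v) :
    V ⟶ W :=
  ModuleCat.ofHom { g with map_smul' := h }

/-- The tensor product of two morphisms. -/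
def tensorMap {V V' W W' : EndMod k A} (φ : V ⟶ V') (ψ : W ⟶ W') :
    D.tensorObj V W ⟶ D.tensorObj V' W' :=
  homOfAdd (D.liftAdd (fun v w => D.tm (φ.hom v) (ψ.hom w))
    (fun v v' w => by rw [map_add, D.add_tm]) (fun v w w' => by rw [map_add, D.tm_add])
    fun v a w => by
      rw [right_smul_eq, map_smul, ← right_smul_eq, D.right_smul_tm, left_smul_eq, left_smul_eq,
        map_smul]) <| by
    intro f t
    induction t using D.tm_induction with
    | zero => simp
    | add s t hs ht => simp only [smul_add, map_add, hs, ht]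
    | tm v w hv =>
      rw [D.smul_tm_of_isCoinv f hv, liftAdd_tm, liftAdd_tm, D.smul_tm_of_isCoinv f (hv.map φ),
        map_smul]

theorem tensorMap_tm {V V' W W' : EndMod k A} (φ : V ⟶ V') (ψ : W ⟶ W') (v : V) (w : W) :
    (D.tensorMap φ ψ).hom (D.tm v w) = D.tm (φ.hom v) (ψ.hom w) := rfl

end lift

end FiniteDualBasis

/-! ### The unit object `A` and its coinvariants -/

namespace EndMod

variable {k : Type u} {A : Type v} [CommRing k] [Ring A] [Algebra k A]

/-- The isomorphism of left `End_k(A)`-modules given by a bijective morphism. -/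
def isoOfInverse {V W : EndMod k A} (φ : V ⟶ W) (g : W → V) (h : ∀ v, g (φ.hom v) = v)
    (h' : ∀ w, φ.hom (g w) = w) : V ≅ W :=
  LinearEquiv.toModuleIso { φ.hom with invFun := g, left_inv := h, right_inv := h' }

variable (k A) in
/-- The left `End_k(A)`-module `A`, with `f · a = f(a)`. -/
def unitObj : EndMod k A := ModuleCat.of (Module.End k A) A

variable (k A) in
/-- The underlying module of `unitObj` is `A`. -/
def unitEquiv : A ≃ₗ[Module.End k A] unitObj k A := LinearEquiv.refl (Module.End k A) A

theorem unitEquiv_symm_smul (f : Module.End k A) (a : unitObj k A) :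
    (unitEquiv k A).symm (f • a) = f ((unitEquiv k A).symm a) := rfl

theorem unitEquiv_symm_right_smul (b : A) (a : unitObj k A) :
    (unitEquiv k A).symm (op b • a) = (unitEquiv k A).symm a * b := by
  rw [right_smul_eq, unitEquiv_symm_smul, LinearMap.mulRight_apply]

theorem unitEquiv_symm_left_smul (b : A) (a : unitObj k A) :
    (unitEquiv k A).symm (b • a) = b * (unitEquiv k A).symm a := by
  rw [left_smul_eq, unitEquiv_symm_smul, LinearMap.mulLeft_apply]

theorem isCoinv_unitEquiv_one : IsCoinv (unitEquiv k A 1) := fun f => by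
  apply (unitEquiv k A).symm.injective
  rw [unitEquiv_symm_smul, unitEquiv_symm_right_smul, LinearEquiv.symm_apply_apply, one_mul]

/-- Apply coinvariance of a to f ∘ (right multiplication by x), whose value at 1 is f(x). Thus left
multiplication by a commutes with all of `End_k(A)`, which makes the left unit constraint linear. -/
theorem IsCoinv.apply_mul {a : unitObj k A} (h : IsCoinv a) (f : Module.End k A) (x : A) :
    f ((unitEquiv k A).symm a * x) = (unitEquiv k A).symm a * f x := by
  have h := congrArg (unitEquiv k A).symm (h (f * LinearMap.mulRight k x))
  rw [unitEquiv_symm_smul, unitEquiv_symm_right_smul] at h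
  simpa using h

theorem IsCoinv.unitEquiv_symm_smul_comm {a : unitObj k A} (h : IsCoinv a) (f : Module.End k A)
    {V : EndMod k A} (v : V) :
    (unitEquiv k A).symm a • f • v = f • (unitEquiv k A).symm a • v := by
  rw [left_smul_eq, left_smul_eq, ← mul_smul, ← mul_smul]
  congr 1
  ext x
  simp [h.apply_mul]

end EndMod

namespace FiniteDualBasis

open EndMod

variable {k : Type u} {A : Type v} [CommRing k] [Ring A] [Algebra k A] {ι : Type w} [Fintype ι]
  (D : FiniteDualBasis k A ι)

/-! ### The unit constraints -/

/-- The morphism `a ⊗ v ↦ a v`. -/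
def leftUnitorHom (V : EndMod k A) : D.tensorObj (unitObj k A) V ⟶ V :=
  homOfAdd (D.liftAdd (fun a v => (unitEquiv k A).symm a • v)
    (fun a a' v => by rw [map_add, add_smul]) (fun a v v' => smul_add _ v v')
    fun a b v => by rw [unitEquiv_symm_right_smul, mul_smul]) <| by
    intro f t
    induction t using D.tm_induction with
    | zero => simp
    | add s t hs ht => simp only [smul_add, map_add, hs, ht]
    | tm a v ha =>
      rw [D.smul_tm_of_isCoinv f ha, liftAdd_tm, liftAdd_tm, ha.unitEquiv_symm_smul_comm]

theorem leftUnitorHom_tm {V : EndMod k A} (a : unitObj k A) (v : V) :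
    (D.leftUnitorHom V).hom (D.tm a v) = (unitEquiv k A).symm a • v := rfl

/-- The isomorphism `A ⊗_A V ≅ V`. -/
def leftUnitor (V : EndMod k A) : D.tensorObj (unitObj k A) V ≅ V :=
  isoOfInverse (D.leftUnitorHom V) (fun v => D.tm (unitEquiv k A 1) v)
    (fun t => by
      induction t using D.tm_induction with
      | zero => rw [map_zero, D.tm_zero]
      | add s t hs ht => rw [map_add, D.tm_add, hs, ht]
      | tm a v _ =>
        rw [leftUnitorHom_tm, ← D.right_smul_tm]
        congr 1
        apply (unitEquiv k A).symm.injective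
        rw [unitEquiv_symm_right_smul, LinearEquiv.symm_apply_apply, one_mul])
    fun v => by rw [leftUnitorHom_tm, LinearEquiv.symm_apply_apply, one_smul]

/-- The morphism `v ⊗ a ↦ v a`. -/
def rightUnitorHom (V : EndMod k A) : D.tensorObj V (unitObj k A) ⟶ V :=
  homOfAdd (D.liftAdd (fun v a => op ((unitEquiv k A).symm a) • v)
    (fun v v' a => smul_add _ v v') (fun v a a' => by rw [map_add, MulOpposite.op_add, add_smul])
    fun v b a => by rw [unitEquiv_symm_left_smul, MulOpposite.op_mul, mul_smul]) <| by
    intro f t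
    induction t using D.tm_induction with
    | zero => simp
    | add s t hs ht => simp only [smul_add, map_add, hs, ht]
    | tm v a hv =>
      rw [D.smul_tm_of_isCoinv f hv, liftAdd_tm, liftAdd_tm, hv.smul_right_smul,
        unitEquiv_symm_smul]

theorem rightUnitorHom_tm {V : EndMod k A} (v : V) (a : unitObj k A) :
    (D.rightUnitorHom V).hom (D.tm v a) = op ((unitEquiv k A).symm a) • v := rfl

/-- The isomorphism `V ⊗_A A ≅ V`. -/
def rightUnitor (V : EndMod k A) : D.tensorObj V (unitObj k A) ≅ V :=
  isoOfInverse (D.rightUnitorHom V) (fun v => D.tm v (unitEquiv k A 1))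
    (fun t => by
      induction t using D.tm_induction with
      | zero => rw [map_zero, D.zero_tm]
      | add s t hs ht => rw [map_add, D.add_tm, hs, ht]
      | tm v a _ =>
        rw [rightUnitorHom_tm, D.right_smul_tm]
        congr 1
        apply (unitEquiv k A).symm.injective
        rw [unitEquiv_symm_left_smul, LinearEquiv.symm_apply_apply, mul_one])
    fun v => by rw [rightUnitorHom_tm, LinearEquiv.symm_apply_apply, MulOpposite.op_one, one_smul]

/-! ### The associativity constraint -/

/-- For `w` in `W`, the map `u ⊗ v ↦ u ⊗ (v ⊗ w)`. -/
def assocAux (U V : EndMod k A) {W : EndMod k A} (w : W) :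
    D.tensorObj U V →+ D.tensorObj U (D.tensorObj V W) :=
  D.liftAdd (fun u v => D.tm u (D.tm v w)) (fun u u' v => D.add_tm _ _ _)
    (fun u v v' => by rw [D.add_tm, D.tm_add])
    fun u a v => by rw [D.right_smul_tm, D.left_smul_tm_eq]

theorem assocAux_tm {U V W : EndMod k A} (u : U) (v : V) (w : W) :
    D.assocAux U V w (D.tm u v) = D.tm u (D.tm v w) := rfl

theorem assocAux_add {U V W : EndMod k A} (t : D.tensorObj U V) (w w' : W) :
    D.assocAux U V (w + w') t = D.assocAux U V w t + D.assocAux U V w' t := by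
  induction t using D.tm_induction with
  | zero => simp
  | add s t hs ht => simp only [map_add, hs, ht]; abel
  | tm u v hu => simp only [assocAux_tm, D.tm_add]

theorem assocAux_right_smul {U V W : EndMod k A} (t : D.tensorObj U V) (a : A) (w : W) :
    D.assocAux U V w (op a • t) = D.assocAux U V (a • w) t := by
  induction t using D.tm_induction with
  | zero => simp
  | add s t hs ht => simp only [smul_add, map_add, hs, ht]
  | tm u v hu => rw [D.right_smul_tm_eq, assocAux_tm, assocAux_tm, D.right_smul_tm]

/-- The map `(u ⊗ v) ⊗ w ↦ u ⊗ (v ⊗ w)`. -/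
def assocHom (U V W : EndMod k A) :
    D.tensorObj (D.tensorObj U V) W ⟶ D.tensorObj U (D.tensorObj V W) :=
  homOfAdd (D.liftAdd (fun t w => D.assocAux U V w t) (fun t t' w => map_add _ t t')
    D.assocAux_add D.assocAux_right_smul) <| by
    intro f t
    induction t using D.tm_induction_left with
    | zero => simp
    | add s t hs ht => simp only [smul_add, map_add, hs, ht]
    | tm u v w hu hv =>
      simp only [liftAdd_tm, D.smul_tm_of_isCoinv f (hu.tm hv), D.smul_tm_of_isCoinv f hu,
        D.smul_tm_of_isCoinv f hv, assocAux_tm]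

theorem assocHom_tm {U V W : EndMod k A} (u : U) (v : V) (w : W) :
    (D.assocHom U V W).hom (D.tm (D.tm u v) w) = D.tm u (D.tm v w) := rfl

/-- For `u` in `U`, the map `v ⊗ w ↦ (u ⊗ v) ⊗ w`. -/
def assocInvAux {U : EndMod k A} (V W : EndMod k A) (u : U) :
    D.tensorObj V W →+ D.tensorObj (D.tensorObj U V) W :=
  D.liftAdd (fun v w => D.tm (D.tm u v) w) (fun v v' w => by rw [D.tm_add, D.add_tm])
    (fun v w w' => D.tm_add _ _ _)
    fun v a w => by rw [← D.right_smul_tm, D.right_smul_tm_eq]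

theorem assocInvAux_tm {U V W : EndMod k A} (u : U) (v : V) (w : W) :
    D.assocInvAux V W u (D.tm v w) = D.tm (D.tm u v) w := rfl

theorem assocInvAux_add {U V W : EndMod k A} (u u' : U) (t : D.tensorObj V W) :
    D.assocInvAux V W (u + u') t = D.assocInvAux V W u t + D.assocInvAux V W u' t := by
  induction t using D.tm_induction with
  | zero => simp
  | add s t hs ht => simp only [map_add, hs, ht]; abel
  | tm v w hv => simp only [assocInvAux_tm, D.add_tm]

theorem assocInvAux_right_smul {U V W : EndMod k A} (u : U) (a : A) (t : D.tensorObj V W) :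
    D.assocInvAux V W (op a • u) t = D.assocInvAux V W u (a • t) := by
  induction t using D.tm_induction with
  | zero => simp
  | add s t hs ht => simp only [smul_add, map_add, hs, ht]
  | tm v w hv => rw [D.left_smul_tm_eq, assocInvAux_tm, assocInvAux_tm, D.right_smul_tm]

/-- The map `u ⊗ (v ⊗ w) ↦ (u ⊗ v) ⊗ w`. -/
def assocInv (U V W : EndMod k A) :
    D.tensorObj U (D.tensorObj V W) →+ D.tensorObj (D.tensorObj U V) W :=
  D.liftAdd (fun u t => D.assocInvAux V W u t) D.assocInvAux_add (fun _ t t' => map_add _ t t')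
    D.assocInvAux_right_smul

theorem assocInv_tm {U V W : EndMod k A} (u : U) (v : V) (w : W) :
    D.assocInv U V W (D.tm u (D.tm v w)) = D.tm (D.tm u v) w := rfl

/-- The isomorphism `(U ⊗_A V) ⊗_A W ≅ U ⊗_A (V ⊗_A W)`. -/
def associator (U V W : EndMod k A) :
    D.tensorObj (D.tensorObj U V) W ≅ D.tensorObj U (D.tensorObj V W) :=
  isoOfInverse (D.assocHom U V W) (D.assocInv U V W)
    -- The inverse is only built as an additive map, so the additive extensionality lemmas are used;
    -- linearity of the inverse is then automatic.
    (DFunLike.congr_fun (D.addHom_ext_left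
      (g := (D.assocInv U V W).comp (D.assocHom U V W).hom.toAddMonoidHom)
      (h := AddMonoidHom.id _) fun _ _ _ _ _ => rfl))
    (DFunLike.congr_fun (D.addHom_ext_right
      (g := (D.assocHom U V W).hom.toAddMonoidHom.comp (D.assocInv U V W))
      (h := AddMonoidHom.id _) fun _ _ _ _ _ => rfl))

/-! ### The braiding -/

/-- The biadditive map `(w, a) ↦ w ⊗ v a`. -/
def braidAux {V : EndMod k A} (W : EndMod k A) (v : V) : W →+ A →+ D.tensorObj W V :=
  AddMonoidHom.mk' (fun w => AddMonoidHom.mk' (fun a => D.tm w (op a • v))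
    fun a b => by simp only [MulOpposite.op_add, add_smul, D.tm_add])
    fun w w' => AddMonoidHom.ext fun a => D.add_tm _ _ _

theorem braidAux_apply {V W : EndMod k A} (v : V) (w : W) (a : A) :
    D.braidAux W v w a = D.tm w (op a • v) := rfl

theorem braidAux_balanced {V W : EndMod k A} (v : V) (c : k) (w : W) (a : A) :
    D.braidAux W v (c • w) a = D.braidAux W v w (c • a) := by
  rw [braidAux_apply, braidAux_apply, D.base_smul_tm, Algebra.smul_def, Algebra.commutes,
    MulOpposite.op_mul, mul_smul, ← base_smul_eq_right]

/-- The map `v ⊗ w ↦ ∑ i, fᵢ · w ⊗ v aᵢ`. -/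
def braidHom (V W : EndMod k A) : D.tensorObj V W ⟶ D.tensorObj W V :=
  homOfAdd (D.liftAdd (fun v w => ∑ i, D.tm (D.endo i • w) (op (D.vec i) • v))
    (fun v v' w => by simp only [smul_add, D.tm_add, Finset.sum_add_distrib])
    (fun v w w' => by simp only [smul_add, D.add_tm, Finset.sum_add_distrib])
    fun v a w => by
      -- Balancedness is ρ(aw) = w₀ ⊗ a w₁, the case where the endomorphism is left multiplication
      -- by a.
      have h := D.sum_endo_smul_smul (D.braidAux W v) (D.braidAux_balanced v)
        (LinearMap.mulLeft k a) w
      simpa only [braidAux_apply, LinearMap.mulLeft_apply, MulOpposite.op_mul, mul_smul,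
        ← left_smul_eq] using h.symm) <| by
    intro f t
    induction t using D.tm_induction with
    | zero => simp
    | add s t hs ht => simp only [smul_add, map_add, hs, ht]
    | tm v w hv =>
      -- Linearity is ρ(f · w) = w₀ ⊗ f(w₁): for coinvariant v, the factor v f(aᵢ) equals f · (v
      -- aᵢ), and f passes the coinvariant fᵢ · w.
      have h := D.sum_endo_smul_smul (D.braidAux W v) (D.braidAux_balanced v) f w
      simpa only [braidAux_apply, D.smul_tm_of_isCoinv f hv, liftAdd_tm, Finset.smul_sum,
        hv.smul_right_smul, D.smul_tm_of_isCoinv f (D.isCoinv_endo_smul _ w)] using h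

theorem braidHom_tm {V W : EndMod k A} (v : V) (w : W) :
    (D.braidHom V W).hom (D.tm v w) = ∑ i, D.tm (D.endo i • w) (op (D.vec i) • v) := rfl

theorem braidHom_tm_of_isCoinv {V W : EndMod k A} (v : V) {w : W} (hw : IsCoinv w) :
    (D.braidHom V W).hom (D.tm v w) = D.tm w v := by
  have h := D.sum_endo_smul_of_isCoinv (D.braidAux W v) (D.braidAux_balanced v) hw
  simpa only [braidHom_tm, braidAux_apply, MulOpposite.op_one, one_smul] using h

/-- On tensors of two coinvariants both maps are flips, so the braiding is a symmetry. -/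
theorem braidHom_comp_braidHom (V W : EndMod k A) :
    D.braidHom V W ≫ D.braidHom W V = 𝟙 (D.tensorObj V W) :=
  D.tensorObj_hom_ext fun v w hv hw => by
    rw [ModuleCat.comp_apply, D.braidHom_tm_of_isCoinv v hw, D.braidHom_tm_of_isCoinv w hv]
    rfl

/-- The isomorphism `V ⊗_A W ≅ W ⊗_A V`. -/
def braiding (V W : EndMod k A) : D.tensorObj V W ≅ D.tensorObj W V where
  hom := D.braidHom V W
  inv := D.braidHom W V
  hom_inv_id := D.braidHom_comp_braidHom V W
  inv_hom_id := D.braidHom_comp_braidHom W V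

/-! ### The braided monoidal category -/

/-- The monoidal category of left `End_k(A)`-modules with tensor product `V ⊗_A W`. -/
@[reducible]
def monoidalCategory : MonoidalCategory (EndMod k A) where
  tensorObj := D.tensorObj
  tensorHom := D.tensorMap
  whiskerLeft V _ _ ψ := D.tensorMap (𝟙 V) ψ
  whiskerRight φ W := D.tensorMap φ (𝟙 W)
  tensorUnit := unitObj k A
  associator := D.associator
  leftUnitor := D.leftUnitor
  rightUnitor := D.rightUnitor
  tensorHom_def _ _ := D.tensorObj_hom_ext fun _ _ _ _ => rfl
  id_tensorHom_id _ _ := D.tensorObj_hom_ext fun _ _ _ _ => rfl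
  tensorHom_comp_tensorHom _ _ _ _ := D.tensorObj_hom_ext fun _ _ _ _ => rfl
  whiskerLeft_id _ _ := D.tensorObj_hom_ext fun _ _ _ _ => rfl
  id_whiskerRight _ _ := D.tensorObj_hom_ext fun _ _ _ _ => rfl
  associator_naturality _ _ _ := D.tensorObj_hom_ext_left fun _ _ _ _ _ _ => rfl
  leftUnitor_naturality {V W} φ := D.tensorObj_hom_ext fun a v _ _ => by
    change (unitEquiv k A).symm a • φ.hom v = φ.hom ((unitEquiv k A).symm a • v)
    rw [left_smul_eq, left_smul_eq, map_smul]
  rightUnitor_naturality {V W} φ := D.tensorObj_hom_ext fun v a _ _ => by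
    change op ((unitEquiv k A).symm a) • φ.hom v = φ.hom (op ((unitEquiv k A).symm a) • v)
    rw [right_smul_eq, right_smul_eq, map_smul]
  pentagon T U V W := D.tensorObj_hom_ext_left fun s v w _ _ _ => by
    rename_i hs _ _
    -- The extensionality lemma treats T ⊗ U as one factor, so its element s must still be split
    -- into pure tensors; its coinvariance is dropped because it does not pass to summands.
    clear hs
    induction s using D.tm_induction with
    | zero => rw [D.zero_tm, D.zero_tm, map_zero, map_zero]
    | add s t hs ht => rw [D.add_tm, D.add_tm, map_add, map_add, hs, ht]
    | tm s u _ => rfl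
  triangle V W := D.tensorObj_hom_ext_left fun v a w _ _ _ => by
    change D.tm v ((unitEquiv k A).symm a • w) = D.tm (op ((unitEquiv k A).symm a) • v) w
    rw [D.right_smul_tm]

theorem braidHom_naturality {V V' W W' : EndMod k A} (φ : V ⟶ V') (ψ : W ⟶ W') :
    D.tensorMap φ ψ ≫ D.braidHom V' W' = D.braidHom V W ≫ D.tensorMap ψ φ :=
  D.tensorObj_hom_ext fun v w _ hw => by
    rw [ModuleCat.comp_apply, ModuleCat.comp_apply, D.braidHom_tm_of_isCoinv v hw,
      tensorMap_tm, tensorMap_tm, D.braidHom_tm_of_isCoinv _ (hw.map ψ)]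

/-- The braiding `v ⊗ w ↦ ∑ i, fᵢ · w ⊗ v aᵢ` on `monoidalCategory`. -/
@[reducible]
def braidedCategory : @BraidedCategory (EndMod k A) _ D.monoidalCategory :=
  letI := D.monoidalCategory
  { braiding := D.braiding
    braiding_naturality_right := fun V _ _ ψ => D.braidHom_naturality (𝟙 V) ψ
    braiding_naturality_left := fun φ W => D.braidHom_naturality φ (𝟙 W)
    hexagon_forward := fun U V W => D.tensorObj_hom_ext_left fun u v w hu hv hw => by
      change (D.assocHom V W U).hom ((D.braidHom U (D.tensorObj V W)).hom (D.tm u (D.tm v w))) =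
        (D.tensorMap (𝟙 V) (D.braidHom U W)).hom ((D.assocHom V U W).hom
          ((D.tensorMap (D.braidHom U V) (𝟙 W)).hom (D.tm (D.tm u v) w)))
      -- Since v ⊗ w is again coinvariant, all three braidings are flips.
      rw [D.braidHom_tm_of_isCoinv u (hv.tm hw), assocHom_tm, tensorMap_tm,
        D.braidHom_tm_of_isCoinv u hv, assocHom_tm, tensorMap_tm]
      exact congrArg (D.tm v) (D.braidHom_tm_of_isCoinv u hw).symm
    hexagon_reverse := fun U V W => D.tensorObj_hom_ext_right fun u v w hu hv hw => by
      change D.assocInv W U V ((D.braidHom (D.tensorObj U V) W).hom (D.tm (D.tm u v) w)) =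
        (D.tensorMap (D.braidHom U W) (𝟙 V)).hom (D.assocInv U W V
          ((D.tensorMap (𝟙 U) (D.braidHom V W)).hom (D.tm u (D.tm v w))))
      rw [D.braidHom_tm_of_isCoinv _ hw, assocInv_tm, tensorMap_tm,
        D.braidHom_tm_of_isCoinv v hw, assocInv_tm, tensorMap_tm]
      exact congrArg (D.tm · v) (D.braidHom_tm_of_isCoinv u hw).symm }

/-! ### Explicit formulas -/

theorem smul_tm_eq_sum {V W : EndMod k A} (f : Module.End k A) (v : V) (w : W) :
    f • D.tm v w = ∑ j, D.tm ((f * LinearMap.mulRight k (D.vec j)) • v) (D.endo j • w) := by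
  conv_lhs => rw [← D.sum_right_smul_endo_smul w, D.tm_sum, Finset.smul_sum]
  refine Finset.sum_congr rfl fun j _ => ?_
  rw [← (D.isCoinv_endo_smul j w).left_smul, ← D.right_smul_tm, mul_smul, ← right_smul_eq]
  -- With w replaced by the coinvariant fⱼ · w and aⱼ moved to the first factor, it remains to see
  -- that f · (x ⊗ w) = (f · x) ⊗ w for coinvariant w. Expanding x = ∑ xᵢ aᵢ with xᵢ coinvariant,
  -- both sides become ∑ xᵢ f(aᵢ) ⊗ w.
  generalize op (D.vec j) • v = x
  conv_lhs => rw [D.tm_eq_sum x, Finset.smul_sum]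
  conv_rhs => rw [← D.sum_right_smul_endo_smul x, Finset.smul_sum, D.sum_tm]
  refine Finset.sum_congr rfl fun i _ => ?_
  have h := D.isCoinv_endo_smul i x
  have h' := D.isCoinv_endo_smul j w
  rw [D.smul_tm_of_isCoinv f h, h'.left_smul, h'.smul_right_smul, h.smul_right_smul,
    D.right_smul_tm, h'.left_smul]

theorem coact_of_isCoinv {V : EndMod k A} {v : V} (hv : IsCoinv v) :
    D.coact V v = v ⊗ₜ[k] 1 := by
  rw [coact_apply]
  exact D.sum_endo_smul_of_isCoinv (AddMonoidHom.mk' (fun v => AddMonoidHom.mk'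
    (fun a => v ⊗ₜ[k] a) (TensorProduct.tmul_add v))
    fun v v' => AddMonoidHom.ext (TensorProduct.add_tmul v v'))
    (fun c v a => TensorProduct.smul_tmul c v a) hv

theorem coact_right_smul_of_isCoinv {V : EndMod k A} {v : V} (hv : IsCoinv v) (a : A) :
    D.coact V (op a • v) = v ⊗ₜ[k] a := by
  have h := (D.comod V).coact_smul a v
  change D.coact V (op a • v) = (LinearMap.mulRight k a).lTensor V (D.coact V v) at h
  rw [h, D.coact_of_isCoinv hv, LinearMap.lTensor_tmul, LinearMap.mulRight_apply, one_mul]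

/-- Since v ⊗ w = ∑ (fᵢ · v ⊗ fⱼ · w) aᵢaⱼ and each tensor in brackets is coinvariant, ρ(xa) = x ⊗ a
for coinvariant x gives the formula. -/
theorem coact_tm {V W : EndMod k A} (v : V) (w : W) :
    D.coact (D.tensorObj V W) (D.tm v w) =
      ∑ i, ∑ j, D.tm (D.endo i • v) (D.endo j • w) ⊗ₜ[k] (D.vec i * D.vec j) := by
  conv_lhs => rw [D.tm_eq_sum v, map_sum]
  refine Finset.sum_congr rfl fun i _ => ?_
  conv_lhs => rw [← D.sum_right_smul_endo_smul w, Finset.smul_sum, D.tm_sum, map_sum]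
  refine Finset.sum_congr rfl fun j _ => ?_
  have h := D.isCoinv_endo_smul i v
  have h' := D.isCoinv_endo_smul j w
  rw [left_smul_eq, h'.smul_right_smul, ← D.right_smul_tm_eq,
    D.coact_right_smul_of_isCoinv (h.tm h'), LinearMap.mulLeft_apply]

theorem coact_unitEquiv (a : A) :
    D.coact (unitObj k A) (unitEquiv k A a) = unitEquiv k A 1 ⊗ₜ[k] a := by
  rw [← D.coact_right_smul_of_isCoinv isCoinv_unitEquiv_one a]
  congr 1
  apply (unitEquiv k A).symm.injective
  rw [unitEquiv_symm_right_smul, LinearEquiv.symm_apply_apply, LinearEquiv.symm_apply_apply,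
    one_mul]

end FiniteDualBasis

/-! ### The isomorphism with the category of comodules -/

theorem ModuleCat.of_congr {R : Type u} [Ring R] {X : Type v} [AddCommGroup X] {m m' : Module R X}
    (h : ∀ (r : R) (x : X), m.smul r x = m'.smul r x) :
    @ModuleCat.of R _ X _ m = @ModuleCat.of R _ X _ m' := by
  congr 1
  exact Module.ext' m m' h

/-- Equality of functors involves transport along equalities of objects. On elements the transport
is a cast, which is trivial when the two carriers are definitionally the same. -/
theorem ModuleCat.eqToHom_hom_apply {R : Type u} [Ring R] {V W : ModuleCat.{v} R} (h : V = W)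
    (x : V) : (eqToHom h).hom x = cast (congrArg ModuleCat.carrier h) x := by
  subst h
  rfl

namespace SweedlerComod

variable {k : Type u} {A : Type v} [CommRing k] [Ring A] [Algebra k A]

theorem eqToHom_toLin_apply {V W : SweedlerComod k A} (h : V = W) (x : V) :
    (eqToHom h : V ⟶ W).toLin x = cast (congrArg carrier h) x := by
  subst h
  rfl

theorem comp_toLin_apply {U V W : SweedlerComod k A} (f : U ⟶ V) (g : V ⟶ W) (x : U) :
    (f ≫ g).toLin x = g.toLin (f.toLin x) := rfl

/-- Two comodule structures on the same abelian group are equal if the actions agree and the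
coactions are given by the same formula. -/
theorem mk_congr {X : Type v} [AddCommGroup X] {m m' : Module k X} {r r' : Module Aᵐᵒᵖ X}
    {t : @IsScalarTower k Aᵐᵒᵖ X _ r.toSMul m.toSMul}
    {t' : @IsScalarTower k Aᵐᵒᵖ X _ r'.toSMul m'.toSMul}
    {ρ : letI := m; X →ₗ[k] X ⊗[k] A} {ρ' : letI := m'; X →ₗ[k] X ⊗[k] A} {c₁ c₂ c₃ c₁' c₂' c₃'}
    (hm : ∀ (c : k) x, m.smul c x = m'.smul c x) (hr : ∀ (a : Aᵐᵒᵖ) x, r.smul a x = r'.smul a x)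
    {ι : Type w} [Fintype ι] (g : ι → X → X) (a : ι → A)
    (hρ : ∀ x, ρ x = ∑ i, @TensorProduct.tmul k _ X A _ _ m _ (g i x) (a i))
    (hρ' : ∀ x, ρ' x = ∑ i, @TensorProduct.tmul k _ X A _ _ m' _ (g i x) (a i)) :
    @mk k A _ _ _ X _ m r t ρ c₁ c₂ c₃ = @mk k A _ _ _ X _ m' r' t' ρ' c₁' c₂' c₃' := by
  -- The type of the coaction depends on the k-module structure, so the module structures must be
  -- identified before the coactions can be compared.
  obtain rfl : m = m' := Module.ext' m m' hm
  obtain rfl : r = r' := Module.ext' r r' hr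
  obtain rfl : ρ = ρ' := by
    let := m
    exact LinearMap.ext fun x => (hρ x).trans (hρ' x).symm
  rfl

theorem endAct_apply_of_eq (V : SweedlerComod k A) (f : Module.End k A) (x : V) :
    V.endAct f x = rightActionMap k A V (f.lTensor V (V.coact x)) := rfl

theorem endAct_algebraMap (V : SweedlerComod k A) (c : k) (x : V) :
    V.endAct (algebraMap k (Module.End k A) c) x = c • x := by
  rw [Algebra.algebraMap_eq_smul_one, endAct, LinearMap.lTensor_smul]
  simp only [LinearMap.comp_apply, LinearMap.smul_apply, map_smul]
  congr 1
  exact V.endAct_one x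

/-- By the right linearity of ρ, v₀(v₁a) is the counit applied to ρ(va). So the right A-action is
recovered from the `End_k(A)`-action. -/
theorem endAct_mulRight (V : SweedlerComod k A) (a : A) (x : V) :
    V.endAct (LinearMap.mulRight k a) x = op a • x := by
  rw [endAct_apply_of_eq, ← V.coact_smul, V.counit]

/-- The identity already holds for each y ⊗ b in place of ρ(x): y fᵢ(b) = aᵢ*(b) y, and ∑ aᵢ*(b) aᵢ
= b. -/
theorem sum_endAct_endo_tmul (V : SweedlerComod k A) {ι : Type w} [Fintype ι]
    (D : FiniteDualBasis k A ι) (x : V) :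
    ∑ i, V.endAct (D.endo i) x ⊗ₜ[k] D.vec i = V.coact x := by
  simp only [endAct_apply_of_eq]
  induction V.coact x with
  | zero => simp
  | add s t hs ht => simp only [map_add, TensorProduct.add_tmul, Finset.sum_add_distrib, hs, ht]
  | tmul y b =>
    have h : ∀ i, op (D.endo i b) • y = D.coord i b • y := fun i => by
      rw [FiniteDualBasis.endo_apply, op_smul, smul_assoc, op_one, one_smul]
    simp only [LinearMap.lTensor_tmul, rightActionMap_tmul, h, TensorProduct.smul_tmul,
      ← TensorProduct.tmul_sum, D.sum_coord_smul_vec]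

end SweedlerComod

namespace FiniteDualBasis

open EndMod

variable {k : Type u} {A : Type v} [CommRing k] [Ring A] [Algebra k A] {ι : Type w} [Fintype ι]
  (D : FiniteDualBasis k A ι)

/-- Expand x = ∑ (fᵢ · x) aᵢ; on each coinvariant fᵢ · x, f acts by f · ((fᵢ · x) aᵢ) = (fᵢ · x)
f(aᵢ). -/
theorem endAct_comod (V : EndMod k A) (f : Module.End k A) (x : V) :
    (D.comod V).endAct f x = f • x := by
  change rightActionMap k A V (f.lTensor V (D.coact V x)) = f • x
  rw [coact_apply, map_sum, map_sum]
  conv_rhs => rw [← D.sum_right_smul_endo_smul x, Finset.smul_sum]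
  refine Finset.sum_congr rfl fun i _ => ?_
  rw [LinearMap.lTensor_tmul, rightActionMap_tmul, (D.isCoinv_endo_smul i x).smul_right_smul]

theorem toEndMod_toComod_obj (V : EndMod k A) :
    (D.toComod ⋙ SweedlerComod.toEndMod k A).obj V = V :=
  ModuleCat.of_congr (D.endAct_comod V)

theorem toComod_comp_toEndMod : D.toComod ⋙ SweedlerComod.toEndMod k A = 𝟭 (EndMod k A) := by
  refine CategoryTheory.Functor.ext D.toEndMod_toComod_obj fun V W φ =>
    ModuleCat.hom_ext (LinearMap.ext fun x => ?_)
  rw [ModuleCat.comp_apply, ModuleCat.comp_apply, ModuleCat.eqToHom_hom_apply,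
    ModuleCat.eqToHom_hom_apply]
  rfl

theorem toComod_toEndMod_obj (V : SweedlerComod k A) :
    (SweedlerComod.toEndMod k A ⋙ D.toComod).obj V = V := by
  refine SweedlerComod.mk_congr (fun c x => V.endAct_algebraMap c x) (fun a x => ?_)
    (fun i x => V.endAct (D.endo i) x) D.vec (fun x => rfl)
    fun x => (V.sum_endAct_endo_tmul D x).symm
  rw [← op_unop a]
  refine (right_smul_eq (V := (SweedlerComod.toEndMod k A).obj V) (unop a) x).trans ?_
  exact V.endAct_mulRight (unop a) x

theorem toEndMod_comp_toComod :
    SweedlerComod.toEndMod k A ⋙ D.toComod = 𝟭 (SweedlerComod k A) := by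
  refine CategoryTheory.Functor.ext D.toComod_toEndMod_obj fun V W φ =>
    SweedlerComod.Hom.ext (LinearMap.ext fun x => ?_)
  rw [SweedlerComod.comp_toLin_apply, SweedlerComod.comp_toLin_apply,
    SweedlerComod.eqToHom_toLin_apply, SweedlerComod.eqToHom_toLin_apply]
  rfl

end FiniteDualBasis

end

theorem mainTheorem4 {k : Type u} {A : Type v} [CommRing k] [Ring A] [Algebra k A]
    [Module.Finite k A] [Module.Projective k A]
    {ι : Type w} [Fintype ι] (D : FiniteDualBasis k A ι) :
    -- left `End_k(A)`-modules and `A ⊗ A`-comodules form isomorphic categories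
    D.toComod ⋙ SweedlerComod.toEndMod k A = 𝟭 (EndMod k A) ∧
    SweedlerComod.toEndMod k A ⋙ D.toComod = 𝟭 (SweedlerComod k A) ∧
    -- a braided monoidal structure, with identifications `e` of the tensor product with `V ⊗_A W`
    -- and `η` of the unit object with the `End_k(A)`-module `A`, where `f • a = f a`
    ∃ (_ : MonoidalCategory (EndMod k A)) (_ : BraidedCategory (EndMod k A))
      (e : ∀ V W : EndMod k A, TensorOver A V W ≃+ ↥(V ⊗ W))
      (η : A ≃ₗ[Module.End k A] ↥(𝟙_ (EndMod k A))),
      -- `f · (v ⊗ w) = ∑ i, fᵢ · v ⊗ f(aᵢ -) · w = ∑ j, f(- aⱼ) · v ⊗ fⱼ · w`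
      (∀ (V W : EndMod k A) (f : Module.End k A) (v : V) (w : W),
        f • e V W (TensorOver.tmul A v w) =
          e V W (∑ i, TensorOver.tmul A (D.endo i • v)
            ((f * LinearMap.mulLeft k (D.vec i)) • w)) ∧
        f • e V W (TensorOver.tmul A v w) =
          e V W (∑ j, TensorOver.tmul A
            ((f * LinearMap.mulRight k (D.vec j)) • v) (D.endo j • w))) ∧
      -- the tensor product of morphisms, the associator and the unitors are those of `⊗_A`
      (∀ (V V' W W' : EndMod k A) (φ : V ⟶ V') (ψ : W ⟶ W') (v : V) (w : W),
        (φ ⊗ₘ ψ).hom (e V W (TensorOver.tmul A v w)) =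
          e V' W' (TensorOver.tmul A (φ.hom v) (ψ.hom w))) ∧
      (∀ (U V W : EndMod k A) (x : U) (v : V) (w : W),
        (α_ U V W).hom.hom
            (e (U ⊗ V) W (TensorOver.tmul A (e U V (TensorOver.tmul A x v)) w)) =
          e U (V ⊗ W) (TensorOver.tmul A x (e V W (TensorOver.tmul A v w)))) ∧
      (∀ (V : EndMod k A) (a : A) (v : V),
        (λ_ V).hom.hom (e (𝟙_ _) V (TensorOver.tmul A (η a) v)) = a • v ∧
        (ρ_ V).hom.hom (e V (𝟙_ _) (TensorOver.tmul A v (η a))) = op a • v) ∧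
      -- the braiding is `v ⊗ w ↦ ∑ i, fᵢ · w ⊗ v aᵢ`
      (∀ (V W : EndMod k A) (v : V) (w : W),
        (β_ V W).hom.hom (e V W (TensorOver.tmul A v w)) =
          e W V (∑ i, TensorOver.tmul A (D.endo i • w) (op (D.vec i) • v))) ∧
      -- the corresponding comodules: `ρ (v ⊗ w) = v₀ ⊗ w₀ ⊗ v₁ w₁` on `V ⊗_A W`, and
      -- `ρ a = 1 ⊗ a` on `A`
      (∀ (V W : EndMod k A) (v : V) (w : W),
        D.coact (V ⊗ W) (e V W (TensorOver.tmul A v w)) =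
          ∑ i, ∑ j, e V W (TensorOver.tmul A (D.endo i • v) (D.endo j • w)) ⊗ₜ[k]
            (D.vec i * D.vec j)) ∧
      (∀ a : A, D.coact (𝟙_ (EndMod k A)) (η a) = η 1 ⊗ₜ[k] a) := by
  -- The identifications `e` and `η` are identity maps, so formulas that repeat the definitions hold
  -- by `rfl`. The second form of the action and the two coactions need an argument.
  refine ⟨D.toComod_comp_toEndMod, D.toEndMod_comp_toComod, D.monoidalCategory, D.braidedCategory,
    D.tensorEquiv, EndMod.unitEquiv k A, fun V W f v w => ⟨rfl, ?_⟩, fun _ _ _ _ _ _ _ _ => rfl,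
    fun _ _ _ _ _ _ => rfl, fun V a v => ⟨rfl, rfl⟩, fun _ _ _ _ => rfl,
    fun V W v w => D.coact_tm v w, D.coact_unitEquiv⟩
  rw [map_sum]
  exact D.smul_tm_eq_sum f v w
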